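/- **Setting.** Fix $d\ge 2$, $I=\{1,\dots,d\}$, $\Sigma_d=I^{\mathbb N}$ with left shift $\sigma$, and write $S_nf=\sum_{k=0}^{n-1}f\circ\sigma^k$. A *conformal iterated function system* $\Phi=(\phi_i)_{i\in I}$ on a non-empty compact connected set $X\subset\mathbb R$ consists of injective contractions $\phi_i:X\to\operatorname{Int}X$ with $\phi_i(\operatorname{Int}X)\cap\phi_j(\operatorname{Int}X)=\emptyset$ for $i\ne j$, such that for some open connected $U\subset\mathbb C$ with $X\subset U$ every $\phi_i$ extends to a conformal map $U\to U$ and, for some $C\ge1$, $|\phi_\omega'(y)|\le C|\phi_\omega'(x)|$ for all $x,y\in U$ and all finite words $\omega=x_1\cdots x_n$, where $\phi_\omega=\phi_{x_1}\circ\cdots\circ\phi_{x_n}$. Let $\Lambda(\Phi)=\bigcap_n\bigcup_{\omega\in I^n}\phi_\omega(X)$ be its limit set, $\delta_\Phi=\dim_H\Lambda(\Phi)$, let $\pi_\Phi(x_1x_2\cdots)=\lim_n\phi_{x_1\cdots x_n}(X)$ be the coding map, and $I_\Phi(x)=\log|\phi_{x_1}'(\pi_\Phi(\sigma x))|$. -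 $\mu_\Phi$ is the $\sigma$-invariant Gibbs probability measure on $\Sigma_d$ for $f=\delta_\Phi I_\Phi$, i.e. $\mu_\Phi([x_1\cdots x_n])\asymp e^{S_nf(x)-nP(f)}$ uniformly in $n$ and $x\in\Sigma_d$, where $P(f)=\lim_n\frac1n\log\sum_{\omega\in I^n}\exp(\sup_{[\omega]}S_nf)$. - $\ell_\Phi(\alpha)=\dim_H\pi_\Phi\bigl(\{x\in\Sigma_d:\lim_n S_nI_\Phi(x)/(-n)=\alpha\}\bigr)$, $\alpha\in\mathbb R$, is the Lyapunov spectrum. - $\Psi$ is a *deformation* of $\Phi$ if there is a bi-Lipschitz bijection $h:\Lambda(\Phi)\to\Lambda(\Psi)$ with $\psi_i=h\circ\phi_i\circ h^{-1}$ on $\Lambda(\Psi)$ for all $i\in I$. A system is *essentially affine* if it is a deformation of a system all of whose generators are affine. - $\Phi\sim\Psi$ means that some system $\Psi_0$ obtained from $\Psi$ by a permutation of its generators is a deformation of $\Phi$. Likewise $\mu_\Phi\cong\mu_\Psi$ means that $\mu_\Phi=\mu_{\Psi_0}$ for some such $\Psi_0$. **Corollary.** Let $\Phi,\Psi$ be essentially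 affine conformal iterated function systems with $d$ generators each. Then the following are equivalent: (i) $\mu_\Phi\cong\mu_\Psi$ and $\delta_\Phi=\delta_\Psi$; (ii) $\Phi\sim\Psi$. Moreover, either of these conditions implies $\ell_\Phi=\ell_\Psi$. -/

import Mathlib

open Set Filter Topology MeasureTheory

/-- `wordMap f [i₁, …, iₙ] = f i₁ ∘ ⋯ ∘ f iₙ`. -/
def wordMap {α : Type*} {d : ℕ} (f : Fin d → α → α) : List (Fin d) → α → α
  | [] => id
  | i :: ω => f i ∘ wordMap f ω

theorem wordMap_comp_perm {α : Type*} {d : ℕ} (f : Fin d → α → α) (τ : Fin d → Fin d)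
    (ω : List (Fin d)) : wordMap (fun i => f (τ i)) ω = wordMap f (ω.map τ) := by
  induction ω with
  | nil => rfl
  | cons i ω ih => simp [wordMap, ih]

/-- A conformal iterated function system `(φ_i : X → Int X)_{i < d}`, with `d ≥ 2` generators, on a
(non-empty) compact connected set `X ⊆ ℝ`. The generators are given as total functions on `ℝ`, of
which only the values on `X` matter. -/
structure ConformalIFS (d : ℕ) where
  two_le : 2 ≤ d
  X : Set ℝ
  isCompact_X : IsCompact X
  isConnected_X : IsConnected X
  φ : Fin d → ℝ → ℝ
  mapsTo_interior : ∀ i, MapsTo (φ i) X (interior X)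
  injOn : ∀ i, InjOn (φ i) X
  contraction : ∀ i, ∃ K : NNReal, K < 1 ∧ LipschitzOnWith K (φ i) X
  /-- Open set condition (its first half, `φ_i (Int X) ⊆ Int X`, is part of `mapsTo_interior`). -/
  openSet : ∀ i j, i ≠ j → Disjoint (φ i '' interior X) (φ j '' interior X)
  /-- Conformality condition and bounded distortion property: the generators extend to conformal
  maps `F i` (holomorphic with non-vanishing derivative) of a complex domain `U ⊇ X` into itself,
  and the derivatives of all their compositions have uniformly bounded distortion on `U`. -/
  conformal : ∃ (U : Set ℂ) (F : Fin d → ℂ → ℂ),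
    IsOpen U ∧ IsConnected U ∧ (∀ x ∈ X, (x : ℂ) ∈ U) ∧
    (∀ i, DifferentiableOn ℂ (F i) U ∧ (∀ z ∈ U, deriv (F i) z ≠ 0) ∧ MapsTo (F i) U U ∧
      ∀ x ∈ X, F i (x : ℂ) = (φ i x : ℂ)) ∧
    ∃ C : ℝ, 1 ≤ C ∧ ∀ ω : List (Fin d), ∀ x ∈ U, ∀ y ∈ U,
      ‖deriv (wordMap F ω) y‖ ≤ C * ‖deriv (wordMap F ω) x‖

/-- The full shift space `Σ_d`, with its product topology and product (= Borel) σ-algebra. -/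
abbrev ShiftSpace (d : ℕ) : Type := ℕ → Fin d

/-- The left shift. -/
def leftShift {d : ℕ} (x : ShiftSpace d) : ShiftSpace d := fun n => x (n + 1)

/-- The cylinder set `[ω₁ … ωₙ]`. -/
def cylinderSet {d n : ℕ} (ω : Fin n → Fin d) : Set (ShiftSpace d) :=
  {x | ∀ k : Fin n, x k = ω k}

/-- The topological pressure
`P(f) = lim (1/n) log ∑_{ω ∈ I^n} exp (sup_{x ∈ [ω]} S_n f (x))` of a potential on `Σ_d`. -/
noncomputable def pressure {d : ℕ} (f : ShiftSpace d → ℝ) : ℝ :=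
  limUnder atTop (fun n : ℕ => (1 / (n : ℝ)) * Real.log
    (∑ ω : Fin n → Fin d, Real.exp (⨆ x : cylinderSet ω, birkhoffSum leftShift f n x.1)))

/-- `μ` is a shift-invariant Gibbs (probability) measure for the potential `f - P(f)`. -/
structure IsInvariantGibbs {d : ℕ} (f : ShiftSpace d → ℝ) (μ : Measure (ShiftSpace d)) : Prop where
  isProbabilityMeasure : IsProbabilityMeasure μ
  invariant : MeasurePreserving leftShift μ μ
  gibbs : ∃ C : ℝ, 0 < C ∧ ∀ (n : ℕ) (ω : Fin n → Fin d), ∀ x ∈ cylinderSet ω,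
    C⁻¹ * Real.exp (birkhoffSum leftShift f n x - n * pressure f) ≤ μ.real (cylinderSet ω) ∧
    μ.real (cylinderSet ω) ≤ C * Real.exp (birkhoffSum leftShift f n x - n * pressure f)

namespace ConformalIFS

variable {d : ℕ}

/-- The limit set `Λ(Φ) = ⋂ₙ ⋃_{ω ∈ I^n} φ_ω (X)`. -/
def limitSet (Φ : ConformalIFS d) : Set ℝ :=
  ⋂ n : ℕ, ⋃ ω ∈ {ω : List (Fin d) | ω.length = n}, wordMap Φ.φ ω '' Φ.X

/-- The coding map `π_Φ (x) = lim φ_{x₁ … xₙ}(X)`. The sets `φ_{x₁ … xₙ}(X)` shrink to a point, so the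
limit is computed along any point of `X`. -/
noncomputable def coding (Φ : ConformalIFS d) (x : ShiftSpace d) : ℝ :=
  limUnder atTop (fun n : ℕ =>
    wordMap Φ.φ (List.ofFn fun k : Fin n => x k) Φ.isConnected_X.nonempty.some)

/-- The canonical geometric potential `I_Φ (x) = log |φ_{x₁}' (π_Φ (σ x))|`. (The point
`π_Φ (σ x)` lies in the interior of `X`, so `deriv` sees only the values of `φ` on `X`.) -/
noncomputable def potential (Φ : ConformalIFS d) (x : ShiftSpace d) : ℝ :=
  Real.log |deriv (Φ.φ (x 0)) (Φ.coding (leftShift x))|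

/-- `δ_Φ`, the Hausdorff dimension of the limit set (which is at most `1`). -/
noncomputable def delta (Φ : ConformalIFS d) : ℝ := (dimH Φ.limitSet).toReal

/-- `μ` is the measure `μ_Φ`: the shift-invariant Gibbs measure for the potential `δ_Φ I_Φ`. -/
def IsGibbsMeasure (Φ : ConformalIFS d) (μ : Measure (ShiftSpace d)) : Prop :=
  IsInvariantGibbs (fun x => Φ.delta * Φ.potential x) μ

/-- The Lyapunov spectrum `ℓ_Φ (α) = dim_H π_Φ {x : lim S_n I_Φ (x) / (-n) = α}`. -/
noncomputable def lyapunovSpectrum (Φ : ConformalIFS d) (α : ℝ) : ENNReal :=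
  dimH (Φ.coding '' {x | Tendsto
    (fun n : ℕ => birkhoffSum leftShift Φ.potential n x / (-(n : ℝ))) atTop (𝓝 α)})

/-- All the generators are affine. -/
def IsAffine (Φ : ConformalIFS d) : Prop :=
  ∀ i, ∃ a b : ℝ, ∀ x ∈ Φ.X, Φ.φ i x = a * x + b

/-- `h` restricts to a bi-Lipschitz bijection `Λ(Φ) → Λ(Ψ)` with `ψ_i = h ∘ φ_i ∘ h⁻¹` for all `i`. -/
structure IsFractalBoundaryCorrespondence (Φ Ψ : ConformalIFS d) (h : ℝ → ℝ) : Prop where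
  bijOn : BijOn h Φ.limitSet Ψ.limitSet
  biLipschitz : ∃ L : ℝ, 0 < L ∧ ∀ x ∈ Φ.limitSet, ∀ y ∈ Φ.limitSet,
    L⁻¹ * |x - y| ≤ |h x - h y| ∧ |h x - h y| ≤ L * |x - y|
  conj : ∀ i, ∀ x ∈ Φ.limitSet, h (Φ.φ i x) = Ψ.φ i (h x)

/-- `Ψ` is a deformation of `Φ`. -/
def IsDeformationOf (Ψ Φ : ConformalIFS d) : Prop :=
  ∃ h : ℝ → ℝ, IsFractalBoundaryCorrespondence Φ Ψ h

/-- Essentially affine systems: deformations of affine systems. -/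
def IsEssentiallyAffine (Ψ : ConformalIFS d) : Prop :=
  ∃ Φ : ConformalIFS d, Φ.IsAffine ∧ Ψ.IsDeformationOf Φ

/-- The system obtained by a permutation of the generators. -/
def permute (Φ : ConformalIFS d) (τ : Equiv.Perm (Fin d)) : ConformalIFS d where
  two_le := Φ.two_le
  X := Φ.X
  isCompact_X := Φ.isCompact_X
  isConnected_X := Φ.isConnected_X
  φ := fun i => Φ.φ (τ i)
  mapsTo_interior := fun i => Φ.mapsTo_interior (τ i)
  injOn := fun i => Φ.injOn (τ i)
  contraction := fun i => Φ.contraction (τ i)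
  openSet := fun i j hij => Φ.openSet (τ i) (τ j) (fun h => hij (τ.injective h))
  conformal := by
    obtain ⟨U, F, h1, h2, h3, h4, C, hC, h5⟩ := Φ.conformal
    refine ⟨U, fun i => F (τ i), h1, h2, h3, fun i => h4 (τ i), C, hC, fun ω x hx y hy => ?_⟩
    rw [wordMap_comp_perm F τ ω]
    exact h5 _ x hx y hy

/-- `Φ ∼ Ψ`: up to a permutation of the generators of `Ψ`, there is a fractal boundary
correspondence between `Φ` and `Ψ`. -/
def Equivalent (Φ Ψ : ConformalIFS d) : Prop :=
  ∃ τ : Equiv.Perm (Fin d), (Ψ.permute τ).IsDeformationOf Φ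

/-- `μ_Φ ≅ μ_Ψ`: equality of the Gibbs measures up to a permutation of the generators of `Ψ`. -/
def GibbsEqualUpToPerm (Φ Ψ : ConformalIFS d) : Prop :=
  ∃ τ : Equiv.Perm (Fin d), ∃ μ : Measure (ShiftSpace d),
    Φ.IsGibbsMeasure μ ∧ (Ψ.permute τ).IsGibbsMeasure μ

end ConformalIFS

/-! Everything is reduced to Birkhoff sums of the geometric potential. The pieces of the limit set
are strongly separated, because the generators map `X` into its interior and the open set condition
makes the coding map injective. With bounded distortion, the distance between two coded points is
therefore comparable to `exp (S_n I)`, where `n` is the length of the common prefix of their codes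
(`exists_coding_comparison`).

A conjugacy commuting with the generators must preserve codes. So a bi-Lipschitz one exists exactly
when the Birkhoff sums of the two potentials stay a bounded distance apart (`isDeformationOf_iff`).
This turns deformation into a symmetric condition on the shift, and the limits of Birkhoff averages
and the dimensions of coded sets are invariant under it.

For an essentially affine system the potential may be replaced, up to bounded sums, by a negative
function `w` of the first letter. Then the pressure is explicit, Bernoulli measures are Gibbs
measures, and the dimension solves Moran's equation `∑ exp (δ w i) = 1` (`delta_spec`), so `δ I` has
pressure zero.

If the Gibbs measures and dimensions agree, both potentials `δ I` have pressure zero, and comparing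
cylinder masses gives bounded differences; cancelling `δ > 0` produces the deformation. Conversely,
bounded differences preserve pressure and the Gibbs inequalities, while bi-Lipschitz maps preserve
dimensions. -/

theorem wordMap_append {α : Type*} {d : ℕ} (f : Fin d → α → α) (ω η : List (Fin d)) :
    wordMap f (ω ++ η) = wordMap f ω ∘ wordMap f η := by
  induction ω with
  | nil => rfl
  | cons i ω ih => simp [wordMap, ih, Function.comp_assoc]

/-- The word formed by the first `n` letters of `x`. -/
def prefixWord {d : ℕ} (x : ShiftSpace d) (n : ℕ) : List (Fin d) :=
  List.ofFn fun k : Fin n => x k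

section prefixWord

variable {d : ℕ}

theorem length_prefixWord (x : ShiftSpace d) (n : ℕ) : (prefixWord x n).length = n := by
  simp [prefixWord]

theorem prefixWord_succ (x : ShiftSpace d) (n : ℕ) :
    prefixWord x (n + 1) = x 0 :: prefixWord (leftShift x) n := by
  simp [prefixWord, List.ofFn_succ, leftShift]

theorem prefixWord_succ_last (x : ShiftSpace d) (n : ℕ) :
    prefixWord x (n + 1) = prefixWord x n ++ [x n] := by
  simp only [prefixWord, List.ofFn_succ', List.concat_eq_append]
  simp

theorem prefixWord_congr {x y : ShiftSpace d} {n : ℕ} (h : ∀ k < n, x k = y k) :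
    prefixWord x n = prefixWord y n := by
  simp only [prefixWord]
  congr 1
  ext k
  rw [h k k.2]

theorem iterate_leftShift_apply (x : ShiftSpace d) (n k : ℕ) :
    (leftShift^[n] x) k = x (k + n) := by
  induction n generalizing x with
  | zero => rfl
  | succ n ih =>
    rw [Function.iterate_succ_apply, ih]
    simp [leftShift, add_assoc]

end prefixWord

/-! ### Coding of the limit set and strong separation -/

namespace ConformalIFS

variable {d : ℕ} (Φ : ConformalIFS d)

theorem mapsTo_X (i : Fin d) : MapsTo (Φ.φ i) Φ.X Φ.X :=
  fun _ hx => interior_subset (Φ.mapsTo_interior i hx)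

theorem mapsTo_wordMap (ω : List (Fin d)) : MapsTo (wordMap Φ.φ ω) Φ.X Φ.X := by
  induction ω with
  | nil => exact mapsTo_id _
  | cons i ω ih => exact (Φ.mapsTo_X i).comp ih

theorem continuousOn_φ (i : Fin d) : ContinuousOn (Φ.φ i) Φ.X := by
  obtain ⟨K, -, hK⟩ := Φ.contraction i
  exact hK.continuousOn

theorem exists_contraction_ratio : ∃ K : ℝ, 0 ≤ K ∧ K < 1 ∧
    ∀ ω, ∀ u ∈ Φ.X, ∀ v ∈ Φ.X,
      |wordMap Φ.φ ω u - wordMap Φ.φ ω v| ≤ K ^ ω.length * |u - v| := by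
  choose k hk1 hk using Φ.contraction
  refine ⟨(Finset.univ.sup k : NNReal), NNReal.coe_nonneg _, ?_, fun ω => ?_⟩
  · have : Finset.univ.sup k < 1 := (Finset.sup_lt_iff (by simp)).2 fun i _ => hk1 i
    exact_mod_cast this
  induction ω with
  | nil => intro u _ v _; simp [wordMap]
  | cons i ω ih =>
    intro u hu v hv
    have h1 := (hk i).dist_le_mul _ (Φ.mapsTo_wordMap ω hu) _ (Φ.mapsTo_wordMap ω hv)
    have h2 : (k i : ℝ) ≤ (Finset.univ.sup k : NNReal) := by
      exact_mod_cast Finset.le_sup (f := k) (Finset.mem_univ i)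
    rw [Real.dist_eq, Real.dist_eq] at h1
    calc |wordMap Φ.φ (i :: ω) u - wordMap Φ.φ (i :: ω) v|
        ≤ k i * |wordMap Φ.φ ω u - wordMap Φ.φ ω v| := h1
      _ ≤ (Finset.univ.sup k : NNReal) *
          ((Finset.univ.sup k : NNReal) ^ ω.length * |u - v|) :=
          mul_le_mul h2 (ih u hu v hv) (abs_nonneg _) (NNReal.coe_nonneg _)
      _ = _ := by rw [List.length_cons]; ring

theorem exists_abs_sub_le : ∃ D : ℝ, ∀ u ∈ Φ.X, ∀ v ∈ Φ.X, |u - v| ≤ D :=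
  ⟨Metric.diam Φ.X, fun _ hu _ hv => by
    rw [← Real.dist_eq]
    exact Metric.dist_le_diam_of_mem Φ.isCompact_X.isBounded hu hv⟩

/-- The images of `X` along longer and longer words shrink to points. -/
theorem tendsto_wordMap_sub (ω : ℕ → List (Fin d)) (hω : ∀ n, (ω n).length = n) {u v : ℕ → ℝ}
    (hu : ∀ n, u n ∈ Φ.X) (hv : ∀ n, v n ∈ Φ.X) :
    Tendsto (fun n => wordMap Φ.φ (ω n) (u n) - wordMap Φ.φ (ω n) (v n)) atTop (𝓝 0) := by
  obtain ⟨K, hK0, hK1, hK⟩ := Φ.exists_contraction_ratio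
  obtain ⟨D, hD⟩ := Φ.exists_abs_sub_le
  refine squeeze_zero_norm (a := fun n => K ^ n * D) (fun n => ?_) ?_
  · have := hK (ω n) _ (hu n) _ (hv n)
    rw [hω] at this
    exact this.trans (mul_le_mul_of_nonneg_left (hD _ (hu n) _ (hv n)) (pow_nonneg hK0 n))
  · simpa using (tendsto_pow_atTop_nhds_zero_of_lt_one hK0 hK1).mul_const D

theorem tendsto_coding (x : ShiftSpace d) {u : ℕ → ℝ} (hu : ∀ n, u n ∈ Φ.X) :
    Tendsto (fun n => wordMap Φ.φ (prefixWord x n) (u n)) atTop (𝓝 (Φ.coding x)) := by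
  have hp : Φ.isConnected_X.nonempty.some ∈ Φ.X := Φ.isConnected_X.nonempty.some_mem
  have hbase : Tendsto
      (fun n => wordMap Φ.φ (prefixWord x n) Φ.isConnected_X.nonempty.some) atTop
      (𝓝 (Φ.coding x)) := by
    obtain ⟨K, hK0, hK1, hK⟩ := Φ.exists_contraction_ratio
    obtain ⟨D, hD⟩ := Φ.exists_abs_sub_le
    refine CauchySeq.tendsto_limUnder (cauchySeq_of_le_geometric K D hK1 fun n => ?_)
    rw [Real.dist_eq, prefixWord_succ_last, wordMap_append]
    have hq := Φ.mapsTo_wordMap [x n] hp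
    have := hK (prefixWord x n) _ hp _ hq
    rw [length_prefixWord] at this
    rw [mul_comm]
    exact this.trans (mul_le_mul_of_nonneg_left (hD _ hp _ hq) (pow_nonneg hK0 n))
  simpa using (Φ.tendsto_wordMap_sub (prefixWord x) (length_prefixWord x) hu
    (fun _ => hp)).add hbase

theorem coding_mem_X (x : ShiftSpace d) : Φ.coding x ∈ Φ.X := by
  have hp : Φ.isConnected_X.nonempty.some ∈ Φ.X := Φ.isConnected_X.nonempty.some_mem
  exact Φ.isCompact_X.isClosed.mem_of_tendsto (Φ.tendsto_coding x fun _ => hp)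
    (Eventually.of_forall fun n => Φ.mapsTo_wordMap _ hp)

theorem coding_eq (x : ShiftSpace d) :
    Φ.coding x = Φ.φ (x 0) (Φ.coding (leftShift x)) := by
  have hp : Φ.isConnected_X.nonempty.some ∈ Φ.X := Φ.isConnected_X.nonempty.some_mem
  have h1 := (tendsto_add_atTop_iff_nat 1).2 (Φ.tendsto_coding x fun _ => hp)
  refine tendsto_nhds_unique h1 ?_
  simp only [prefixWord_succ]
  exact (Φ.continuousOn_φ (x 0) _ (Φ.coding_mem_X _)).tendsto.comp
    (tendsto_nhdsWithin_iff.2 ⟨Φ.tendsto_coding (leftShift x) fun _ => hp,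
      Eventually.of_forall fun n => Φ.mapsTo_wordMap _ hp⟩)

theorem coding_mem_interior (x : ShiftSpace d) : Φ.coding x ∈ interior Φ.X := by
  rw [coding_eq]
  exact Φ.mapsTo_interior _ (Φ.coding_mem_X _)

theorem wordMap_coding (x : ShiftSpace d) (n : ℕ) :
    wordMap Φ.φ (prefixWord x n) (Φ.coding (leftShift^[n] x)) = Φ.coding x := by
  induction n generalizing x with
  | zero => rfl
  | succ n ih =>
    rw [prefixWord_succ, Function.iterate_succ_apply, Φ.coding_eq x, ← ih (leftShift x)]
    rfl

/-- A point lying in the images of `X` along prefixes of `x` is the point coded by `x`. -/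
theorem eq_coding {x : ShiftSpace d} {y : ℝ} {u : ℕ → ℝ} (hu : ∀ n, u n ∈ Φ.X)
    (h : ∀ n, wordMap Φ.φ (prefixWord x n) (u n) = y) : y = Φ.coding x := by
  have := Φ.tendsto_coding x hu
  simp only [h] at this
  exact tendsto_nhds_unique tendsto_const_nhds this

/-- The open set condition excludes different letters, and injectivity does the rest. The interior
matters: images of boundary points under different generators may coincide. -/
theorem eq_of_φ_eq {i j : Fin d} {u v : ℝ} (hu : u ∈ interior Φ.X) (hv : v ∈ interior Φ.X)
    (h : Φ.φ i u = Φ.φ j v) : i = j ∧ u = v := by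
  have hij : i = j := by
    by_contra hij
    exact (Set.disjoint_left.1 (Φ.openSet i j hij)) ⟨u, hu, rfl⟩ ⟨v, hv, h.symm⟩
  subst hij
  exact ⟨rfl, Φ.injOn i (interior_subset hu) (interior_subset hv) h⟩

theorem limitSet_subset_X : Φ.limitSet ⊆ Φ.X := by
  intro y hy
  have := mem_iInter.1 hy 0
  simp only [mem_iUnion, mem_image] at this
  obtain ⟨ω, -, u, hu, rfl⟩ := this
  exact Φ.mapsTo_wordMap ω hu

theorem exists_mem_limitSet_φ_eq {y : ℝ} (hy : y ∈ Φ.limitSet) :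
    ∃ i, ∃ z ∈ Φ.limitSet, Φ.φ i z = y := by
  have key : ∀ n : ℕ, ∃ i, ∃ ω : List (Fin d), ω.length = n + 1 ∧ ∃ u ∈ Φ.X,
      Φ.φ i (wordMap Φ.φ ω u) = y := by
    intro n
    -- After the first letter is removed at level `n + 2`, a nonempty word remains, so the preimage
    -- lies in the interior and `eq_of_φ_eq` applies. This makes the preimage the same for every
    -- level.
    have := mem_iInter.1 hy (n + 2)
    simp only [mem_iUnion, mem_image] at this
    obtain ⟨ω, hω, u, hu, h⟩ := this
    match ω, hω with
    | i :: ω, hω => exact ⟨i, ω, by simpa using hω, u, hu, h⟩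
  have hint : ∀ (n : ℕ) (ω : List (Fin d)), ω.length = n + 1 → ∀ u ∈ Φ.X,
      wordMap Φ.φ ω u ∈ interior Φ.X := by
    intro n ω hω u hu
    match ω, hω with
    | i :: ω, _ => exact Φ.mapsTo_interior i (Φ.mapsTo_wordMap ω hu)
  obtain ⟨i, ω, hω, u, hu, h⟩ := key 0
  refine ⟨i, wordMap Φ.φ ω u, mem_iInter.2 fun n => ?_, h⟩
  simp only [mem_iUnion]
  obtain rfl | ⟨m, rfl⟩ : n = 0 ∨ ∃ m, n = m + 1 := by cases n <;> simp
  · exact ⟨[], rfl, _, Φ.mapsTo_wordMap ω hu, rfl⟩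
  · obtain ⟨j, η, hη, v, hv, h'⟩ := key m
    refine ⟨η, hη, v, hv, ?_⟩
    exact (Φ.eq_of_φ_eq (hint _ _ hη v hv) (hint _ _ hω u hu) (h'.trans h.symm)).2

theorem range_coding : range Φ.coding = Φ.limitSet := by
  apply Subset.antisymm
  · rintro _ ⟨x, rfl⟩
    refine mem_iInter.2 fun n => ?_
    simp only [mem_iUnion]
    exact ⟨prefixWord x n, length_prefixWord x n, _, Φ.coding_mem_X _, Φ.wordMap_coding x n⟩
  · intro y hy
    choose i z hz hiz using fun y : Φ.limitSet => Φ.exists_mem_limitSet_φ_eq y.2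
    -- `T` is the expanding inverse map on the limit set; the itinerary of a point under `T` is a
    -- code for it.
    let T : Φ.limitSet → Φ.limitSet := fun y => ⟨z y, hz y⟩
    refine ⟨fun n => i (T^[n] ⟨y, hy⟩), (Φ.eq_coding
      (fun n => Φ.limitSet_subset_X (T^[n] ⟨y, hy⟩).2) fun n => ?_).symm⟩
    have : ∀ (n : ℕ) (w : Φ.limitSet), wordMap Φ.φ (prefixWord (fun n => i (T^[n] w)) n)
        (T^[n] w) = w := by
      intro n
      induction n with
      | zero => intro w; rfl
      | succ n ih =>
        intro w
        rw [prefixWord_succ, Function.iterate_succ_apply]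
        have h1 : leftShift (fun n => i (T^[n] w)) = fun n => i (T^[n] (T w)) := rfl
        rw [h1, wordMap, Function.comp_apply, ih (T w)]
        exact hiz w
    exact this n ⟨y, hy⟩

/-- Coded points are interior points of `X`, so letters can be recovered one at a time by
`eq_of_φ_eq`. -/
theorem coding_injective : Function.Injective Φ.coding := by
  intro x y h
  have key : ∀ (n : ℕ) (x y : ShiftSpace d), Φ.coding x = Φ.coding y → x n = y n := by
    intro n
    induction n with
    | zero =>
      intro x y h
      rw [Φ.coding_eq x, Φ.coding_eq y] at h
      exact (Φ.eq_of_φ_eq (Φ.coding_mem_interior _) (Φ.coding_mem_interior _) h).1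
    | succ n ih =>
      intro x y h
      rw [Φ.coding_eq x, Φ.coding_eq y] at h
      exact ih _ _ (Φ.eq_of_φ_eq (Φ.coding_mem_interior _) (Φ.coding_mem_interior _) h).2
  exact funext fun n => key n x y h

theorem continuous_coding : Continuous Φ.coding := by
  obtain ⟨K, hK0, hK1, hK⟩ := Φ.exists_contraction_ratio
  obtain ⟨D, hD⟩ := Φ.exists_abs_sub_le
  refine continuous_iff_continuousAt.2 fun x => Metric.tendsto_nhds.2 fun ε hε => ?_
  have hlim : Tendsto (fun n => K ^ n * D) atTop (𝓝 0) := by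
    simpa using (tendsto_pow_atTop_nhds_zero_of_lt_one hK0 hK1).mul_const D
  obtain ⟨n, hn⟩ := (hlim.eventually (gt_mem_nhds hε)).exists
  have hev : ∀ᶠ y in 𝓝 x, ∀ k ∈ Finset.range n, y k = x k := by
    refine (Filter.eventually_all_finset _).2 fun k _ => ?_
    have := (continuous_apply (A := fun _ : ℕ => Fin d) k).continuousAt (x := x)
    exact this.eventually (IsOpen.mem_nhds (isOpen_discrete {x k}) rfl)
  filter_upwards [hev] with y hy
  have hp : prefixWord y n = prefixWord x n :=
    prefixWord_congr fun k hk => hy k (Finset.mem_range.2 hk)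
  rw [Real.dist_eq, ← Φ.wordMap_coding x n, ← Φ.wordMap_coding y n, hp]
  have h1 := hK (prefixWord x n) _ (Φ.coding_mem_X (leftShift^[n] y)) _
    (Φ.coding_mem_X (leftShift^[n] x))
  rw [length_prefixWord] at h1
  exact (h1.trans (mul_le_mul_of_nonneg_left (hD _ (Φ.coding_mem_X _) _ (Φ.coding_mem_X _))
    (pow_nonneg hK0 n))).trans_lt hn

/-- The first-level pieces of the limit set are separated. -/
theorem exists_separation : ∃ c : ℝ, 0 < c ∧ ∀ x y : ShiftSpace d, x 0 ≠ y 0 →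
    c ≤ |Φ.coding x - Φ.coding y| := by
  -- The pairs with different first letters form a compact set on which the distance is continuous
  -- and, by injectivity of the coding, positive.
  have hcl : IsClosed {p : ShiftSpace d × ShiftSpace d | p.1 0 ≠ p.2 0} := by
    have : {p : ShiftSpace d × ShiftSpace d | p.1 0 ≠ p.2 0} =
        (fun p : ShiftSpace d × ShiftSpace d => (p.1 0, p.2 0)) ⁻¹' {q | q.1 ≠ q.2} := rfl
    rw [this]
    exact (isClosed_discrete _).preimage (by fun_prop)
  have hcont : Continuous fun p : ShiftSpace d × ShiftSpace d =>
      |Φ.coding p.1 - Φ.coding p.2| := by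
    have := Φ.continuous_coding
    fun_prop
  obtain ⟨c, hc, h⟩ := hcl.isCompact.exists_forall_le' (f := fun p : ShiftSpace d × ShiftSpace d =>
      |Φ.coding p.1 - Φ.coding p.2|) hcont.continuousOn (a := 0) (by
    rintro ⟨x, y⟩ hxy
    refine abs_pos.2 (sub_ne_zero.2 fun h => hxy ?_)
    rw [Φ.coding_injective h])
  exact ⟨c, hc, fun x y hxy => h (x, y) hxy⟩

end ConformalIFS

/-! ### Bounded distortion and the metric on the limit set -/

namespace ConformalIFS

variable {d : ℕ} (Φ : ConformalIFS d)

theorem mapsTo_interior_wordMap (ω : List (Fin d)) :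
    MapsTo (wordMap Φ.φ ω) (interior Φ.X) (interior Φ.X) := by
  induction ω with
  | nil => exact mapsTo_id _
  | cons i ω ih => exact ((Φ.mapsTo_interior i).mono_left interior_subset).comp ih

/-- Bounded distortion of the real derivatives in the interior of `X`. -/
theorem exists_deriv_wordMap_le : ∃ C : ℝ, 1 ≤ C ∧ ∀ ω : List (Fin d),
    (∀ x ∈ interior Φ.X, DifferentiableAt ℝ (wordMap Φ.φ ω) x ∧ deriv (wordMap Φ.φ ω) x ≠ 0) ∧
    ∀ x ∈ interior Φ.X, ∀ y ∈ interior Φ.X,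
      |deriv (wordMap Φ.φ ω) y| ≤ C * |deriv (wordMap Φ.φ ω) x| := by
  obtain ⟨U, F, hU, -, hXU, hF, C, hC1, hC⟩ := Φ.conformal
  have hgen : ∀ i, ∀ x ∈ interior Φ.X, ∃ r : ℝ, r ≠ 0 ∧ HasDerivAt (Φ.φ i) r x ∧
      HasDerivAt (F i) (r : ℂ) (x : ℂ) := by
    intro i x hx
    obtain ⟨hdiff, hne, -, hext⟩ := hF i
    have hxU := hXU x (interior_subset hx)
    have hFx : HasDerivAt (F i) (deriv (F i) x) (x : ℂ) :=
      (hdiff.differentiableAt (hU.mem_nhds hxU)).hasDerivAt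
    have hev : (fun y : ℝ => F i (y : ℂ)) =ᶠ[𝓝 x] fun y => (Φ.φ i y : ℂ) := by
      filter_upwards [isOpen_interior.mem_nhds hx] with y hy
      exact hext y (interior_subset hy)
    -- The holomorphic extension is real-valued on the real axis near `x`, so its complex derivative
    -- there is real and equals the real derivative.
    have h1 : HasDerivAt (Φ.φ i) (deriv (F i) x).re x := by
      refine hFx.real_of_complex.congr_of_eventuallyEq ?_
      filter_upwards [hev] with y hy
      rw [hy, Complex.ofReal_re]
    have h2 : HasDerivAt (fun y : ℝ => (Φ.φ i y : ℂ)) (deriv (F i) x) x :=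
      hFx.comp_ofReal.congr_of_eventuallyEq hev.symm
    have h3 : deriv (F i) x = ((deriv (F i) x).re : ℂ) := h2.unique h1.ofReal_comp
    refine ⟨_, fun h0 => hne x hxU ?_, h1, h3 ▸ hFx⟩
    rw [h3, h0, Complex.ofReal_zero]
  have hind : ∀ ω, ∀ x ∈ interior Φ.X, ∃ r : ℝ, r ≠ 0 ∧ HasDerivAt (wordMap Φ.φ ω) r x ∧
      HasDerivAt (wordMap F ω) (r : ℂ) (x : ℂ) ∧
      wordMap F ω (x : ℂ) = ((wordMap Φ.φ ω x : ℝ) : ℂ) := by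
    intro ω
    induction ω with
    | nil => exact fun x _ => ⟨1, one_ne_zero, hasDerivAt_id x, by
        rw [Complex.ofReal_one]; exact hasDerivAt_id (x : ℂ), rfl⟩
    | cons i ω ih =>
      intro x hx
      obtain ⟨r, hr, h1, h2, h3⟩ := ih x hx
      have hx' := Φ.mapsTo_interior_wordMap ω hx
      obtain ⟨s, hs, h4, h5⟩ := hgen i _ hx'
      refine ⟨s * r, mul_ne_zero hs hr, h4.comp x h1, ?_, ?_⟩
      · rw [← h3] at h5
        rw [Complex.ofReal_mul]
        exact h5.comp (x : ℂ) h2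
      · simp only [wordMap, Function.comp_apply]
        rw [h3]
        exact (hF i).2.2.2 _ (interior_subset hx')
  refine ⟨C, hC1, fun ω => ⟨fun x hx => ?_, fun x hx y hy => ?_⟩⟩
  · obtain ⟨r, hr, h1, -⟩ := hind ω x hx
    exact ⟨h1.differentiableAt, by rwa [h1.deriv]⟩
  · obtain ⟨r, -, h1, h2, -⟩ := hind ω x hx
    obtain ⟨s, -, h3, h4, -⟩ := hind ω y hy
    have := hC ω x (hXU x (interior_subset hx)) y (hXU y (interior_subset hy))
    rw [h2.deriv, h4.deriv] at this
    rw [h1.deriv, h3.deriv]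
    simpa using this

theorem continuousOn_wordMap (ω : List (Fin d)) : ContinuousOn (wordMap Φ.φ ω) Φ.X := by
  induction ω with
  | nil => exact continuousOn_id
  | cons i ω ih => exact (Φ.continuousOn_φ i).comp ih (Φ.mapsTo_wordMap ω)

/-- By the mean value theorem the difference quotient is a derivative at some point, which
distortion lets one replace by any interior point `z`. -/
theorem exists_wordMap_sub_comparison : ∃ C : ℝ, 1 ≤ C ∧ ∀ ω : List (Fin d),
    ∀ z ∈ interior Φ.X, ∀ u ∈ Φ.X, ∀ v ∈ Φ.X,
      |wordMap Φ.φ ω u - wordMap Φ.φ ω v| ≤ C * |deriv (wordMap Φ.φ ω) z| * |u - v| ∧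
      |deriv (wordMap Φ.φ ω) z| * |u - v| ≤ C * |wordMap Φ.φ ω u - wordMap Φ.φ ω v| := by
  obtain ⟨C, hC1, hC⟩ := Φ.exists_deriv_wordMap_le
  refine ⟨C, hC1, fun ω z hz => ?_⟩
  obtain ⟨hd, hC⟩ := hC ω
  have key : ∀ u ∈ Φ.X, ∀ v ∈ Φ.X, u < v →
      |wordMap Φ.φ ω u - wordMap Φ.φ ω v| ≤ C * |deriv (wordMap Φ.φ ω) z| * |u - v| ∧
      |deriv (wordMap Φ.φ ω) z| * |u - v| ≤ C * |wordMap Φ.φ ω u - wordMap Φ.φ ω v| := by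
    intro u hu v hv huv
    -- `X` is an interval, so the intermediate point is interior even when `u` and `v` are
    -- endpoints.
    have hsub : Icc u v ⊆ Φ.X :=
      (isPreconnected_iff_ordConnected.1 Φ.isConnected_X.isPreconnected).out hu hv
    have hsub' : Ioo u v ⊆ interior Φ.X :=
      interior_maximal (Ioo_subset_Icc_self.trans hsub) isOpen_Ioo
    obtain ⟨c, hc, h⟩ := exists_deriv_eq_slope (wordMap Φ.φ ω) huv
      ((Φ.continuousOn_wordMap ω).mono hsub)
      fun x hx => (hd x (hsub' hx)).1.differentiableWithinAt
    have heq : |wordMap Φ.φ ω u - wordMap Φ.φ ω v| =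
        |deriv (wordMap Φ.φ ω) c| * |u - v| := by
      rw [abs_sub_comm, abs_sub_comm u v, ← abs_mul, h,
        div_mul_cancel₀ _ (sub_ne_zero.2 huv.ne')]
    rw [heq, ← mul_assoc]
    exact ⟨mul_le_mul_of_nonneg_right (hC z hz c (hsub' hc)) (abs_nonneg _),
      mul_le_mul_of_nonneg_right (hC c (hsub' hc) z hz) (abs_nonneg _)⟩
  intro u hu v hv
  rcases lt_trichotomy u v with h | rfl | h
  · exact key u hu v hv h
  · simp
  · have := key v hv u hu h
    rwa [abs_sub_comm u v, abs_sub_comm (wordMap Φ.φ ω u)]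

theorem deriv_φ_ne_zero (i : Fin d) {x : ℝ} (hx : x ∈ interior Φ.X) :
    DifferentiableAt ℝ (Φ.φ i) x ∧ deriv (Φ.φ i) x ≠ 0 := by
  obtain ⟨C, -, hC⟩ := Φ.exists_deriv_wordMap_le
  exact (hC [i]).1 x hx

/-- This is the chain rule along the orbit of the code. -/
theorem exp_birkhoffSum_potential (n : ℕ) (x : ShiftSpace d) :
    Real.exp (birkhoffSum leftShift Φ.potential n x) =
      |deriv (wordMap Φ.φ (prefixWord x n)) (Φ.coding (leftShift^[n] x))| := by
  obtain ⟨C, -, hC⟩ := Φ.exists_deriv_wordMap_le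
  induction n generalizing x with
  | zero => simp [prefixWord, wordMap]
  | succ n ih =>
    have hd := ((hC (prefixWord (leftShift x) n)).1 _
      (Φ.coding_mem_interior (leftShift^[n] (leftShift x)))).1
    have hd' := Φ.deriv_φ_ne_zero (x 0) (Φ.coding_mem_interior (leftShift x))
    rw [birkhoffSum_succ', Real.exp_add, ih, prefixWord_succ, Function.iterate_succ_apply, wordMap,
      deriv_comp, wordMap_coding, abs_mul, potential, Real.exp_log (abs_pos.2 hd'.2)]
    · rw [wordMap_coding]; exact hd'.1
    · exact hd

/-- The distance of two points of the limit set is comparable to the derivative along the longest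
common prefix of their codes. -/
theorem exists_coding_comparison : ∃ C : ℝ, 0 < C ∧ ∀ (n : ℕ) (x y : ShiftSpace d),
    (∀ k < n, x k = y k) →
    |Φ.coding x - Φ.coding y| ≤ C * Real.exp (birkhoffSum leftShift Φ.potential n x) ∧
    (x n ≠ y n →
      Real.exp (birkhoffSum leftShift Φ.potential n x) ≤ C * |Φ.coding x - Φ.coding y|) := by
  obtain ⟨C, hC1, hC⟩ := Φ.exists_wordMap_sub_comparison
  obtain ⟨D, hD⟩ := Φ.exists_abs_sub_le
  obtain ⟨c, hc, hsep⟩ := Φ.exists_separation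
  have hC0 : 0 < C := by linarith
  refine ⟨max (C * D) (C / c), lt_max_of_lt_right (by positivity), fun n x y hxy => ?_⟩
  have h := hC (prefixWord x n) _ (Φ.coding_mem_interior (leftShift^[n] x))
    _ (Φ.coding_mem_X (leftShift^[n] x)) _ (Φ.coding_mem_X (leftShift^[n] y))
  rw [← exp_birkhoffSum_potential, wordMap_coding, prefixWord_congr hxy, wordMap_coding] at h
  have hE := Real.exp_pos (birkhoffSum leftShift Φ.potential n x)
  generalize Real.exp (birkhoffSum leftShift Φ.potential n x) = E at *
  constructor
  · calc |Φ.coding x - Φ.coding y| ≤ _ := h.1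
      _ ≤ C * E * D := mul_le_mul_of_nonneg_left
          (hD _ (Φ.coding_mem_X _) _ (Φ.coding_mem_X _)) (by positivity)
      _ = C * D * E := by ring
      _ ≤ _ := mul_le_mul_of_nonneg_right (le_max_left _ _) hE.le
  · intro hne
    -- The tails differ in their first letter, so they are at least `c` apart before contraction.
    have h0 := hsep (leftShift^[n] x) (leftShift^[n] y) (by
      simpa [iterate_leftShift_apply] using hne)
    calc E = E * c / c := by field_simp
      _ ≤ C * |Φ.coding x - Φ.coding y| / c := 
          div_le_div_of_nonneg_right ((mul_le_mul_of_nonneg_left h0 hE.le).trans h.2) hc.le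
      _ = C / c * |Φ.coding x - Φ.coding y| := by ring
      _ ≤ _ := mul_le_mul_of_nonneg_right (le_max_right _ _) (abs_nonneg _)

end ConformalIFS

/-! ### Potentials up to bounded Birkhoff sums -/

section BoundedSumDiff

variable {d : ℕ}

/-- The Birkhoff sums of `f` and `g` along the shift stay within a bounded distance. -/
def HasBoundedSumDiff (f g : ShiftSpace d → ℝ) : Prop :=
  ∃ C : ℝ, ∀ (n : ℕ) (x : ShiftSpace d),
    |birkhoffSum leftShift f n x - birkhoffSum leftShift g n x| ≤ C

theorem HasBoundedSumDiff.symm {f g : ShiftSpace d → ℝ} (h : HasBoundedSumDiff f g) :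
    HasBoundedSumDiff g f := by
  obtain ⟨C, hC⟩ := h
  exact ⟨C, fun n x => by rw [abs_sub_comm]; exact hC n x⟩

theorem HasBoundedSumDiff.trans {f g k : ShiftSpace d → ℝ} (h : HasBoundedSumDiff f g)
    (h' : HasBoundedSumDiff g k) : HasBoundedSumDiff f k := by
  obtain ⟨C, hC⟩ := h
  obtain ⟨C', hC'⟩ := h'
  exact ⟨C + C', fun n x => (abs_sub_le _ _ _).trans (add_le_add (hC n x) (hC' n x))⟩

theorem birkhoffSum_const_mul (f : ShiftSpace d → ℝ) (s : ℝ) (n : ℕ) (x : ShiftSpace d) :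
    birkhoffSum leftShift (fun x => s * f x) n x = s * birkhoffSum leftShift f n x := by
  simp [birkhoffSum, Finset.mul_sum]

theorem HasBoundedSumDiff.const_mul {f g : ShiftSpace d → ℝ} (h : HasBoundedSumDiff f g)
    (s : ℝ) : HasBoundedSumDiff (fun x => s * f x) (fun x => s * g x) := by
  obtain ⟨C, hC⟩ := h
  refine ⟨|s| * C, fun n x => ?_⟩
  rw [birkhoffSum_const_mul, birkhoffSum_const_mul, ← mul_sub, abs_mul]
  exact mul_le_mul_of_nonneg_left (hC n x) (abs_nonneg s)

theorem HasBoundedSumDiff.of_const_mul {f g : ShiftSpace d → ℝ} {s : ℝ} (hs : s ≠ 0)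
    (h : HasBoundedSumDiff (fun x => s * f x) (fun x => s * g x)) : HasBoundedSumDiff f g := by
  have := h.const_mul s⁻¹
  simpa only [inv_mul_cancel_left₀ hs] using this

theorem birkhoffSum_comp_zero (w : Fin d → ℝ) (n : ℕ) (x : ShiftSpace d) :
    birkhoffSum leftShift (fun x => w (x 0)) n x = ∑ k ∈ Finset.range n, w (x k) := by
  simp [birkhoffSum, iterate_leftShift_apply]

/-- Bounded differences of Birkhoff sums do not affect the limits of Birkhoff averages. -/
theorem HasBoundedSumDiff.tendsto_iff {f g : ShiftSpace d → ℝ} (h : HasBoundedSumDiff f g)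
    (x : ShiftSpace d) (α : ℝ) :
    Tendsto (fun n : ℕ => birkhoffSum leftShift f n x / (-(n : ℝ))) atTop (𝓝 α) ↔
      Tendsto (fun n : ℕ => birkhoffSum leftShift g n x / (-(n : ℝ))) atTop (𝓝 α) := by
  obtain ⟨C, hC⟩ := h
  have h0 : Tendsto (fun n : ℕ => birkhoffSum leftShift f n x / (-(n : ℝ)) -
      birkhoffSum leftShift g n x / (-(n : ℝ))) atTop (𝓝 0) := by
    refine squeeze_zero_norm (a := fun n : ℕ => C / (n : ℝ)) (fun n => ?_)
      (tendsto_const_div_atTop_nhds_zero_nat C)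
    rw [← sub_div, norm_div, norm_neg, Real.norm_eq_abs, RCLike.norm_natCast]
    exact div_le_div_of_nonneg_right (hC n x) (Nat.cast_nonneg n)
  constructor
  · intro h1
    simpa using h1.sub h0
  · intro h1
    simpa using h1.add h0

/-- The distance of `π x` and `π y` is comparable to `exp (S_n f (x))`, if `n` is the length of the
longest common prefix of `x` and `y`. -/
def IsMetricPotential (π f : ShiftSpace d → ℝ) : Prop :=
  ∃ C : ℝ, 0 < C ∧ ∀ (n : ℕ) (x y : ShiftSpace d), (∀ k < n, x k = y k) →
    |π x - π y| ≤ C * Real.exp (birkhoffSum leftShift f n x) ∧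
    (x n ≠ y n → Real.exp (birkhoffSum leftShift f n x) ≤ C * |π x - π y|)

theorem IsMetricPotential.congr {π f g : ShiftSpace d → ℝ} (h : IsMetricPotential π f)
    (hfg : HasBoundedSumDiff f g) : IsMetricPotential π g := by
  obtain ⟨C, hC0, hC⟩ := h
  obtain ⟨B, hB⟩ := hfg
  refine ⟨C * Real.exp B, by positivity, fun n x y hxy => ?_⟩
  have h1 := abs_le.1 (hB n x)
  have h2 : Real.exp (birkhoffSum leftShift f n x) ≤
      Real.exp B * Real.exp (birkhoffSum leftShift g n x) := by
    rw [← Real.exp_add]; exact Real.exp_le_exp.2 (by linarith)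
  have h3 : Real.exp (birkhoffSum leftShift g n x) ≤
      Real.exp B * Real.exp (birkhoffSum leftShift f n x) := by
    rw [← Real.exp_add]; exact Real.exp_le_exp.2 (by linarith)
  constructor
  · rw [mul_assoc]
    exact (hC n x y hxy).1.trans (mul_le_mul_of_nonneg_left h2 hC0.le)
  · intro hne
    refine h3.trans ?_
    rw [mul_comm C, mul_assoc]
    exact mul_le_mul_of_nonneg_left ((hC n x y hxy).2 hne) (Real.exp_pos B).le

theorem exists_first_ne {x y : ShiftSpace d} (h : x ≠ y) :
    ∃ n, (∀ k < n, x k = y k) ∧ x n ≠ y n := by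
  have h' : ∃ n, x n ≠ y n := Function.ne_iff.1 h
  classical
  exact ⟨Nat.find h', fun k hk => not_not.1 (Nat.find_min h' hk), Nat.find_spec h'⟩

theorem IsMetricPotential.exists_abs_sub_le {π π' f : ShiftSpace d → ℝ}
    (h : IsMetricPotential π f) (h' : IsMetricPotential π' f) :
    ∃ L : ℝ, 0 < L ∧ ∀ x y, |π x - π y| ≤ L * |π' x - π' y| := by
  obtain ⟨C, hC0, hC⟩ := h
  obtain ⟨C', hC0', hC'⟩ := h'
  refine ⟨C * C', by positivity, fun x y => ?_⟩
  by_cases hxy : x = y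
  · simp [hxy]
  obtain ⟨n, hn, hne⟩ := exists_first_ne hxy
  rw [mul_assoc]
  exact (hC n x y hn).1.trans (mul_le_mul_of_nonneg_left ((hC' n x y hn).2 hne) hC0.le)

/-- At every `x` and every level `n`, both exponentials can be read off from the distance between
`x` and a point branching off at exactly that level. -/
theorem IsMetricPotential.hasBoundedSumDiff (hd : 2 ≤ d) {π π' f g : ShiftSpace d → ℝ}
    (h : IsMetricPotential π f) (h' : IsMetricPotential π' g) {L : ℝ} (hL : 0 < L)
    (h1 : ∀ x y, |π x - π y| ≤ L * |π' x - π' y|) (h2 : ∀ x y, |π' x - π' y| ≤ L * |π x - π y|) :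
    HasBoundedSumDiff f g := by
  obtain ⟨C, hC0, hC⟩ := h
  obtain ⟨C', hC0', hC'⟩ := h'
  have hnt : Nontrivial (Fin d) := Fin.nontrivial_iff_two_le.2 hd
  refine ⟨Real.log (C * C' * L), fun n x => ?_⟩
  -- Changing only the letter at position `n` gives such a point; this is where two letters are
  -- needed.
  obtain ⟨j, hj⟩ := exists_ne (x n)
  have hxy : ∀ k < n, x k = Function.update x n j k := fun k hk => by
    rw [Function.update_of_ne hk.ne]
  have hne : x n ≠ Function.update x n j n := by simpa using hj.symm
  have a := hC n x _ hxy
  have b := hC' n x _ hxy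
  have c1 := h1 x (Function.update x n j)
  have c2 := h2 x (Function.update x n j)
  have hpos : 0 < C * C' * L := by positivity
  have e1 : Real.exp (birkhoffSum leftShift f n x) ≤
      C * C' * L * Real.exp (birkhoffSum leftShift g n x) := by
    calc _ ≤ _ := a.2 hne
      _ ≤ C * (L * (C' * Real.exp (birkhoffSum leftShift g n x))) := by
        gcongr; exact c1.trans (mul_le_mul_of_nonneg_left b.1 hL.le)
      _ = _ := by ring
  have e2 : Real.exp (birkhoffSum leftShift g n x) ≤
      C * C' * L * Real.exp (birkhoffSum leftShift f n x) := by
    calc _ ≤ _ := b.2 hne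
      _ ≤ C' * (L * (C * Real.exp (birkhoffSum leftShift f n x))) := by
        gcongr; exact c2.trans (mul_le_mul_of_nonneg_left a.1 hL.le)
      _ = _ := by ring
  rw [← Real.exp_log hpos, ← Real.exp_add, Real.exp_le_exp] at e1 e2
  exact abs_le.2 ⟨by linarith, by linarith⟩

end BoundedSumDiff

/-! ### Deformations in terms of potentials -/

namespace ConformalIFS

variable {d : ℕ}

theorem isMetricPotential_coding (Φ : ConformalIFS d) :
    IsMetricPotential Φ.coding Φ.potential :=
  Φ.exists_coding_comparison

/-- The conjugacy relation places `h (Φ.coding x)` in the image of `Ψ.X` along every prefix of `x`,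
and only one point lies in all of them. -/
theorem IsFractalBoundaryCorrespondence.apply_coding {Φ Ψ : ConformalIFS d} {h : ℝ → ℝ}
    (H : IsFractalBoundaryCorrespondence Φ Ψ h) (x : ShiftSpace d) :
    h (Φ.coding x) = Ψ.coding x := by
  have hmem : ∀ x, Φ.coding x ∈ Φ.limitSet := fun x => Φ.range_coding ▸ mem_range_self x
  refine Ψ.eq_coding (u := fun n => h (Φ.coding (leftShift^[n] x)))
    (fun n => Ψ.limitSet_subset_X (H.bijOn.mapsTo (hmem _))) fun n => ?_
  induction n generalizing x with
  | zero => rfl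
  | succ n ih =>
    rw [prefixWord_succ, Function.iterate_succ_apply, Φ.coding_eq x, H.conj _ _ (hmem _),
      ← ih (leftShift x)]
    rfl

/-- Codes are preserved, so being bi-Lipschitz compares two metrics on the shift space, each
determined up to constants by the exponentials of its Birkhoff sums. -/
theorem isDeformationOf_iff {Φ Ψ : ConformalIFS d} :
    Ψ.IsDeformationOf Φ ↔ HasBoundedSumDiff Φ.potential Ψ.potential := by
  constructor
  · rintro ⟨h, H⟩
    obtain ⟨L, hL, hLip⟩ := H.biLipschitz
    have hmem : ∀ x, Φ.coding x ∈ Φ.limitSet := fun x => Φ.range_coding ▸ mem_range_self x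
    refine Φ.isMetricPotential_coding.hasBoundedSumDiff Φ.two_le Ψ.isMetricPotential_coding hL
      (fun x y => ?_) fun x y => ?_
    · have := (hLip _ (hmem x) _ (hmem y)).1
      rwa [H.apply_coding, H.apply_coding, inv_mul_le_iff₀ hL] at this
    · have := (hLip _ (hmem x) _ (hmem y)).2
      rwa [H.apply_coding, H.apply_coding] at this
  · intro hb
    have hΨ := Ψ.isMetricPotential_coding.congr hb.symm
    obtain ⟨L₁, hL₁, h₁⟩ := Φ.isMetricPotential_coding.exists_abs_sub_le hΨ
    obtain ⟨L₂, hL₂, h₂⟩ := hΨ.exists_abs_sub_le Φ.isMetricPotential_coding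
    have : Nonempty (ShiftSpace d) := ⟨fun _ => ⟨0, by have := Φ.two_le; omega⟩⟩
    -- The only possible conjugacy matches points with equal codes; its values off the limit set are
    -- irrelevant.
    let h : ℝ → ℝ := Ψ.coding ∘ Function.invFun Φ.coding
    have hh : ∀ x, h (Φ.coding x) = Ψ.coding x := fun x => by
      simp [h, Function.leftInverse_invFun Φ.coding_injective x]
    refine ⟨h, ⟨⟨?_, ?_, ?_⟩, ⟨max L₁ L₂, lt_max_of_lt_left hL₁, ?_⟩, ?_⟩⟩
    · rw [← range_coding, ← range_coding]
      rintro _ ⟨x, rfl⟩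
      exact ⟨x, (hh x).symm⟩
    · rw [← range_coding]
      rintro _ ⟨x, rfl⟩ _ ⟨y, rfl⟩ hxy
      rw [hh, hh] at hxy
      rw [Ψ.coding_injective hxy]
    · rw [← range_coding, ← range_coding]
      rintro _ ⟨x, rfl⟩
      exact ⟨_, mem_range_self x, hh x⟩
    · rw [← range_coding]
      rintro _ ⟨x, rfl⟩ _ ⟨y, rfl⟩
      rw [hh, hh, inv_mul_le_iff₀ (lt_max_of_lt_left hL₁)]
      exact ⟨(h₁ x y).trans (mul_le_mul_of_nonneg_right (le_max_left _ _) (abs_nonneg _)),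
        (h₂ x y).trans (mul_le_mul_of_nonneg_right (le_max_right _ _) (abs_nonneg _))⟩
    · rw [← range_coding]
      rintro i _ ⟨x, rfl⟩
      -- Applying the generator `i` is prepending the letter `i` to the code.
      let y : ShiftSpace d := fun n => Nat.casesOn n i x
      have hΦ : Φ.coding y = Φ.φ i (Φ.coding x) := Φ.coding_eq y
      have hΨ : Ψ.coding y = Ψ.φ i (Ψ.coding x) := Ψ.coding_eq y
      rw [← hΦ, hh, hh, hΨ]

theorem IsDeformationOf.symm {Φ Ψ : ConformalIFS d} (h : Ψ.IsDeformationOf Φ) :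
    Φ.IsDeformationOf Ψ :=
  isDeformationOf_iff.2 (isDeformationOf_iff.1 h).symm

theorem IsDeformationOf.dimH_coding_image_le {Φ Ψ : ConformalIFS d} (h : Ψ.IsDeformationOf Φ)
    (A : Set (ShiftSpace d)) : dimH (Ψ.coding '' A) ≤ dimH (Φ.coding '' A) := by
  obtain ⟨h, H⟩ := h
  obtain ⟨L, hL, hLip⟩ := H.biLipschitz
  have heq : Ψ.coding '' A = h '' (Φ.coding '' A) := by
    rw [image_image]
    exact image_congr fun x _ => (H.apply_coding x).symm
  rw [heq]
  refine (LipschitzOnWith.of_dist_le_mul (K := ⟨L, hL.le⟩) ?_).dimH_image_le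
  rintro _ ⟨x, -, rfl⟩ _ ⟨y, -, rfl⟩
  exact (hLip _ (Φ.range_coding ▸ mem_range_self x) _ (Φ.range_coding ▸ mem_range_self y)).2

theorem IsDeformationOf.dimH_coding_image_eq {Φ Ψ : ConformalIFS d} (h : Ψ.IsDeformationOf Φ)
    (A : Set (ShiftSpace d)) : dimH (Ψ.coding '' A) = dimH (Φ.coding '' A) :=
  le_antisymm (h.dimH_coding_image_le A) (h.symm.dimH_coding_image_le A)

theorem IsDeformationOf.delta_eq {Φ Ψ : ConformalIFS d} (h : Ψ.IsDeformationOf Φ) :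
    Φ.delta = Ψ.delta := by
  rw [delta, delta, ← range_coding, ← range_coding, ← image_univ, ← image_univ,
    h.dimH_coding_image_eq]

theorem IsDeformationOf.lyapunovSpectrum_eq {Φ Ψ : ConformalIFS d} (h : Ψ.IsDeformationOf Φ) :
    Φ.lyapunovSpectrum = Ψ.lyapunovSpectrum := by
  funext α
  rw [lyapunovSpectrum, lyapunovSpectrum, h.dimH_coding_image_eq]
  congr 2
  ext x
  exact (isDeformationOf_iff.1 h).tendsto_iff x α

/-! ### Permuting the generators -/

section permute

variable (Φ : ConformalIFS d) (τ : Equiv.Perm (Fin d))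

theorem coding_permute (x : ShiftSpace d) :
    (Φ.permute τ).coding x = Φ.coding (fun n => τ (x n)) := by
  refine Φ.eq_coding (u := fun n => (Φ.permute τ).coding (leftShift^[n] x))
    (fun n => (Φ.permute τ).coding_mem_X _) fun n => ?_
  have h := (Φ.permute τ).wordMap_coding x n
  have h' : prefixWord (fun n => τ (x n)) n = (prefixWord x n).map τ := by
    simp [prefixWord, List.map_ofFn, Function.comp_def]
  rw [h', ← wordMap_comp_perm]
  exact h

theorem potential_permute (x : ShiftSpace d) :
    (Φ.permute τ).potential x = Φ.potential (fun n => τ (x n)) := by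
  rw [potential, coding_permute]
  rfl

theorem birkhoffSum_potential_permute (n : ℕ) (x : ShiftSpace d) :
    birkhoffSum leftShift (Φ.permute τ).potential n x =
      birkhoffSum leftShift Φ.potential n (fun n => τ (x n)) := by
  refine Finset.sum_congr rfl fun k _ => ?_
  rw [potential_permute]
  congr 1
  ext m
  simp [iterate_leftShift_apply]

theorem surjective_perm_comp : Function.Surjective fun (x : ShiftSpace d) n => τ (x n) :=
  fun y => ⟨fun n => τ.symm (y n), by simp⟩

theorem delta_permute : (Φ.permute τ).delta = Φ.delta := by
  have : (Φ.permute τ).coding = Φ.coding ∘ fun x n => τ (x n) :=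
    funext (Φ.coding_permute τ)
  rw [delta, delta, ← range_coding, ← range_coding, this, (surjective_perm_comp τ).range_comp]

theorem lyapunovSpectrum_permute : (Φ.permute τ).lyapunovSpectrum = Φ.lyapunovSpectrum := by
  funext α
  rw [lyapunovSpectrum, lyapunovSpectrum]
  congr 1
  apply Subset.antisymm
  · rintro _ ⟨x, hx, rfl⟩
    simp only [mem_ofPred_eq, birkhoffSum_potential_permute] at hx
    exact ⟨_, hx, (Φ.coding_permute τ x).symm⟩
  · rintro _ ⟨y, hy, rfl⟩
    obtain ⟨x, rfl⟩ := surjective_perm_comp τ y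
    refine ⟨x, ?_, Φ.coding_permute τ x⟩
    simp only [mem_ofPred_eq, birkhoffSum_potential_permute]
    exact hy

end permute

/-- The slopes are constant, nonzero by conformality, and of modulus below one by contraction tested
on two distinct points of `X`. -/
theorem IsAffine.exists_potential_eq {Φ : ConformalIFS d} (h : Φ.IsAffine) :
    ∃ w : Fin d → ℝ, (∀ i, w i < 0) ∧ ∀ x, Φ.potential x = w (x 0) := by
  choose a b hab using h
  have hd : ∀ i, ∀ x ∈ interior Φ.X, deriv (Φ.φ i) x = a i := by
    intro i x hx
    have : HasDerivAt (Φ.φ i) (a i) x := by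
      have h1 : HasDerivAt (fun x => a i * x + b i) (a i * 1) x :=
        ((hasDerivAt_id x).const_mul (a i)).add_const (b i)
      rw [mul_one] at h1
      refine h1.congr_of_eventuallyEq ?_
      filter_upwards [isOpen_interior.mem_nhds hx] with y hy
      exact hab i y (interior_subset hy)
    exact this.deriv
  refine ⟨fun i => Real.log |a i|, fun i => ?_, fun x => ?_⟩
  · have h2 := Φ.two_le
    let x : ShiftSpace d := fun _ => ⟨0, by omega⟩
    let y : ShiftSpace d := fun _ => ⟨1, by omega⟩
    have hxy : Φ.coding x ≠ Φ.coding y := fun h => by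
      have := congrFun (Φ.coding_injective h) 0
      simp [x, y] at this
    have ha : a i ≠ 0 := by
      rw [← hd i _ (Φ.coding_mem_interior x)]
      exact (Φ.deriv_φ_ne_zero i (Φ.coding_mem_interior x)).2
    obtain ⟨K, hK1, hK⟩ := Φ.contraction i
    have h3 := hK.dist_le_mul _ (Φ.coding_mem_X x) _ (Φ.coding_mem_X y)
    have hpos : 0 < |Φ.coding x - Φ.coding y| := abs_pos.2 (sub_ne_zero.2 hxy)
    rw [hab i _ (Φ.coding_mem_X x), hab i _ (Φ.coding_mem_X y), Real.dist_eq, Real.dist_eq,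
      add_sub_add_right_eq_sub, ← mul_sub, abs_mul] at h3
    exact Real.log_neg (abs_pos.2 ha)
      ((le_of_mul_le_mul_right h3 hpos).trans_lt (by exact_mod_cast hK1))
  · rw [potential, hd _ _ (Φ.coding_mem_interior _)]

theorem IsEssentiallyAffine.exists_hasBoundedSumDiff {Φ : ConformalIFS d}
    (h : Φ.IsEssentiallyAffine) : ∃ w : Fin d → ℝ, (∀ i, w i < 0) ∧
      HasBoundedSumDiff Φ.potential (fun x => w (x 0)) := by
  obtain ⟨Φ₀, h0, h1⟩ := h
  obtain ⟨w, hw, hpot⟩ := h0.exists_potential_eq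
  refine ⟨w, hw, ?_⟩
  rw [← funext hpot]
  exact (isDeformationOf_iff.1 h1).symm

end ConformalIFS

/-! ### Bernoulli measures -/

section Bernoulli

variable {d : ℕ}

/-- The Bernoulli measure with weights `exp (v i)`. -/
noncomputable def bernoulliMeasure (v : Fin d → ℝ) (hv : ∑ i, Real.exp (v i) = 1) :
    Measure (ShiftSpace d) :=
  Measure.infinitePi fun _ : ℕ => (PMF.ofFintype (fun i => ENNReal.ofReal (Real.exp (v i))) (by
    rw [← ENNReal.ofReal_sum_of_nonneg fun i _ => (Real.exp_pos _).le, hv,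
      ENNReal.ofReal_one])).toMeasure

variable (v : Fin d → ℝ) (hv : ∑ i, Real.exp (v i) = 1)

instance : IsProbabilityMeasure (bernoulliMeasure v hv) := by
  unfold bernoulliMeasure
  infer_instance

theorem bernoulliMeasure_cylinder (x : ShiftSpace d) (n : ℕ) :
    bernoulliMeasure v hv {y | ∀ k < n, y k = x k} =
      ENNReal.ofReal (Real.exp (∑ k ∈ Finset.range n, v (x k))) := by
  have : {y : ShiftSpace d | ∀ k < n, y k = x k} =
      Set.pi (Finset.range n) fun k => {x k} := by
    ext y
    simp [Set.mem_pi]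
  rw [this, bernoulliMeasure, Measure.infinitePi_pi _ fun _ _ => MeasurableSet.of_discrete,
    Real.exp_sum, ENNReal.ofReal_prod_of_nonneg fun _ _ => (Real.exp_pos _).le]
  refine Finset.prod_congr rfl fun k _ => ?_
  rw [PMF.toMeasure_apply_singleton _ _ MeasurableSet.of_discrete, PMF.ofFintype_apply]

theorem measurable_leftShift : Measurable (leftShift : ShiftSpace d → ShiftSpace d) :=
  measurable_pi_lambda _ fun n => measurable_pi_apply (n + 1)

theorem measurePreserving_leftShift_bernoulliMeasure :
    MeasurePreserving leftShift (bernoulliMeasure v hv) (bernoulliMeasure v hv) := by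
  refine ⟨measurable_leftShift, Measure.eq_infinitePi _ fun s t ht => ?_⟩
  rw [Measure.map_apply measurable_leftShift
    (MeasurableSet.pi s.countable_toSet fun i _ => ht i)]
  have : leftShift ⁻¹' (Set.pi s t : Set (ShiftSpace d)) =
      Set.pi (s.map (addRightEmbedding 1)) fun k => t (k - 1) := by
    ext y
    simp [Set.mem_pi, leftShift]
  rw [this, bernoulliMeasure, Measure.infinitePi_pi _ fun k _ => ht (k - 1), Finset.prod_map]
  simp

end Bernoulli

/-! ### Pressure and Gibbs measures -/

section Pressure

variable {d : ℕ}

/-- For `w` alone the partition function is exactly the `n`-th power of `∑ exp (w i)`; the bounded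
error changes its logarithm by at most `C`, which disappears after division by `n`. -/
theorem pressure_eq_log_sum [NeZero d] {f : ShiftSpace d → ℝ} {w : Fin d → ℝ}
    (h : HasBoundedSumDiff f (fun x => w (x 0))) :
    pressure f = Real.log (∑ i, Real.exp (w i)) := by
  obtain ⟨C, hC⟩ := h
  have hZ : 0 < ∑ i, Real.exp (w i) :=
    Finset.sum_pos (fun _ _ => Real.exp_pos _) Finset.univ_nonempty
  set Z := ∑ i, Real.exp (w i)
  have hpow : ∀ n : ℕ, ∑ ω : Fin n → Fin d, Real.exp (∑ k, w (ω k)) = Z ^ n := fun n => by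
    rw [Fintype.sum_pow]
    simp [Real.exp_sum]
  have hbound : ∀ (n : ℕ) (ω : Fin n → Fin d) (x : cylinderSet ω),
      |birkhoffSum leftShift f n x.1 - ∑ k, w (ω k)| ≤ C := by
    rintro n ω ⟨x, hx⟩
    have := hC n x
    rw [birkhoffSum_comp_zero, Finset.sum_range] at this
    simpa [hx _] using this
  have hsup : ∀ (n : ℕ) (ω : Fin n → Fin d),
      |(⨆ x : cylinderSet ω, birkhoffSum leftShift f n x.1) - ∑ k, w (ω k)| ≤ C := by
    intro n ω
    have hb := fun x => abs_le.1 (hbound n ω x)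
    -- Padding `ω` with the letter `0` shows that the cylinder is nonempty, so the supremum is not a
    -- default value.
    let x₀ : cylinderSet ω := ⟨fun k => if h : k < n then ω ⟨k, h⟩ else 0, fun k => by simp⟩
    have : Nonempty (cylinderSet ω) := ⟨x₀⟩
    have h1 : (⨆ x : cylinderSet ω, birkhoffSum leftShift f n x.1) ≤ C + ∑ k, w (ω k) :=
      ciSup_le fun x => by linarith [(hb x).2]
    have h2 : birkhoffSum leftShift f n x₀.1 ≤
        ⨆ x : cylinderSet ω, birkhoffSum leftShift f n x.1 :=
      le_ciSup (f := fun x : cylinderSet ω => birkhoffSum leftShift f n x.1)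
        ⟨C + ∑ k, w (ω k), by rintro _ ⟨x, rfl⟩; show _ ≤ _; linarith [(hb x).2]⟩ x₀
    exact abs_le.2 ⟨by linarith [(hb x₀).1], by linarith⟩
  refine Tendsto.limUnder_eq ?_
  refine tendsto_iff_norm_sub_tendsto_zero.2 ?_
  refine squeeze_zero' (g := fun n : ℕ => C / (n : ℝ))
    (Eventually.of_forall fun _ => norm_nonneg _) ?_ (tendsto_const_div_atTop_nhds_zero_nat C)
  filter_upwards [eventually_gt_atTop 0] with n hn
  have hn' : (0 : ℝ) < n := by exact_mod_cast hn
  set S := ∑ ω : Fin n → Fin d,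
    Real.exp (⨆ x : cylinderSet ω, birkhoffSum leftShift f n x.1) with hS
  have hSpos : 0 < S := Finset.sum_pos (fun _ _ => Real.exp_pos _) Finset.univ_nonempty
  have hS1 : S ≤ Real.exp C * Z ^ n := by
    rw [← hpow, Finset.mul_sum]
    refine Finset.sum_le_sum fun ω _ => ?_
    rw [← Real.exp_add]
    exact Real.exp_le_exp.2 (by linarith [(abs_le.1 (hsup n ω)).2])
  have hS2 : Z ^ n ≤ Real.exp C * S := by
    rw [← hpow, Finset.mul_sum]
    refine Finset.sum_le_sum fun ω _ => ?_
    rw [← Real.exp_add]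
    exact Real.exp_le_exp.2 (by linarith [(abs_le.1 (hsup n ω)).1])
  have hl1 := Real.log_le_log hSpos hS1
  have hl2 := Real.log_le_log (pow_pos hZ n) hS2
  rw [Real.log_mul (Real.exp_pos C).ne' (pow_pos hZ n).ne', Real.log_exp, Real.log_pow] at hl1
  rw [Real.log_mul (Real.exp_pos C).ne' hSpos.ne', Real.log_exp, Real.log_pow] at hl2
  have heq : 1 / (n : ℝ) * Real.log S - Real.log Z = (Real.log S - n * Real.log Z) / n := by
    field_simp
  rw [heq, norm_div, Real.norm_eq_abs, RCLike.norm_natCast]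
  exact div_le_div_of_nonneg_right (abs_le.2 ⟨by linarith, by linarith⟩) hn'.le

theorem cylinderSet_eq {n : ℕ} {ω : Fin n → Fin d} {x : ShiftSpace d} (hx : x ∈ cylinderSet ω) :
    cylinderSet ω = {y | ∀ k < n, y k = x k} := by
  ext y
  exact ⟨fun hy k hk => (hy ⟨k, hk⟩).trans (hx ⟨k, hk⟩).symm,
    fun hy k => (hy k k.2).trans (hx k)⟩

/-- A potential with bounded differences from one depending only on the first letter has a
Bernoulli measure as an invariant Gibbs measure. -/
theorem exists_isInvariantGibbs [NeZero d] {f : ShiftSpace d → ℝ} {w : Fin d → ℝ}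
    (h : HasBoundedSumDiff f (fun x => w (x 0))) : ∃ μ, IsInvariantGibbs f μ := by
  have hZ : 0 < ∑ i, Real.exp (w i) :=
    Finset.sum_pos (fun _ _ => Real.exp_pos _) Finset.univ_nonempty
  have hv : ∑ i, Real.exp (w i - pressure f) = 1 := by
    simp only [Real.exp_sub, ← Finset.sum_div]
    rw [pressure_eq_log_sum h, Real.exp_log hZ, div_self hZ.ne']
  obtain ⟨C, hC⟩ := h
  refine ⟨bernoulliMeasure _ hv, inferInstance, measurePreserving_leftShift_bernoulliMeasure _ hv,
    Real.exp C, Real.exp_pos C, fun n ω x hx => ?_⟩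
  rw [cylinderSet_eq hx, measureReal_def, bernoulliMeasure_cylinder,
    ENNReal.toReal_ofReal (Real.exp_pos _).le, ← Real.exp_neg, ← Real.exp_add, ← Real.exp_add,
    Real.exp_le_exp, Real.exp_le_exp, Finset.sum_sub_distrib]
  have := abs_le.1 (hC n x)
  rw [birkhoffSum_comp_zero] at this
  simp only [Finset.sum_const, Finset.card_range, nsmul_eq_mul]
  exact ⟨by linarith [this.2], by linarith [this.1]⟩

/-- A common invariant Gibbs measure forces normalized potentials to have bounded differences. -/
theorem IsInvariantGibbs.hasBoundedSumDiff {f g : ShiftSpace d → ℝ}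
    {μ : Measure (ShiftSpace d)} (hf : IsInvariantGibbs f μ) (hg : IsInvariantGibbs g μ)
    (hP : pressure f = pressure g) : HasBoundedSumDiff f g := by
  obtain ⟨C, hC0, hC⟩ := hf.gibbs
  obtain ⟨D, hD0, hD⟩ := hg.gibbs
  refine ⟨Real.log (C * D), fun n x => ?_⟩
  have hx : x ∈ cylinderSet fun k : Fin n => x k := fun _ => rfl
  have h1 := hC n _ x hx
  have h2 := hD n _ x hx
  -- With equal pressures the terms linear in `n` cancel when the two estimates of the same cylinder
  -- mass are compared.
  rw [hP] at h1
  have e1 := h1.1.trans h2.2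
  have e2 := h2.1.trans h1.2
  rw [inv_mul_le_iff₀ hC0, ← mul_assoc, ← Real.exp_log (mul_pos hC0 hD0), ← Real.exp_add,
    Real.exp_le_exp] at e1
  rw [inv_mul_le_iff₀ hD0, ← mul_assoc, mul_comm D, ← Real.exp_log (mul_pos hC0 hD0),
    ← Real.exp_add, Real.exp_le_exp] at e2
  exact abs_le.2 ⟨by linarith, by linarith⟩

end Pressure

/-! ### Moran's dimension formula -/

section Moran

variable {d : ℕ}

/-- The sum is `d ≥ 2` at `s = 0` and tends to zero at infinity, so the intermediate value theorem
applies; for `s ≤ 0` it is at least `d`. -/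
theorem exists_sum_exp_mul_eq_one (hd : 2 ≤ d) {w : Fin d → ℝ} (hw : ∀ i, w i < 0) :
    ∃ s : ℝ, 0 < s ∧ ∑ i, Real.exp (s * w i) = 1 := by
  have hcont : Continuous fun s : ℝ => ∑ i, Real.exp (s * w i) := by fun_prop
  have hlim : Tendsto (fun s : ℝ => ∑ i, Real.exp (s * w i)) atTop (𝓝 0) := by
    have : ∀ i ∈ Finset.univ, Tendsto (fun s : ℝ => Real.exp (s * w i)) atTop (𝓝 0) :=
      fun i _ => Real.tendsto_exp_atBot.comp (tendsto_id.atTop_mul_const_of_neg (hw i))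
    simpa using tendsto_finsetSum _ this
  have hd' : (2 : ℝ) ≤ d := by exact_mod_cast hd
  obtain ⟨b, hb⟩ := (hlim.eventually (gt_mem_nhds one_pos)).exists
  obtain ⟨s, hs⟩ := mem_range_of_exists_le_of_exists_ge hcont (c := 1) ⟨b, hb.le⟩
    ⟨0, by simp; linarith⟩
  refine ⟨s, ?_, hs⟩
  by_contra hs0
  have : ∑ _i : Fin d, (1 : ℝ) ≤ ∑ i, Real.exp (s * w i) := Finset.sum_le_sum fun i _ =>
    Real.one_le_exp (mul_nonneg_of_nonpos_of_nonpos (not_lt.1 hs0) (hw i).le)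
  simp only [Finset.sum_const, Finset.card_univ, Fintype.card_fin, nsmul_eq_mul, mul_one] at this
  simp only at hs
  linarith

theorem exists_sum_le_mul [NeZero d] {w : Fin d → ℝ} (hw : ∀ i, w i < 0) : ∃ a : ℝ, a < 0 ∧
    ∀ (n : ℕ) (x : ShiftSpace d), ∑ k ∈ Finset.range n, w (x k) ≤ n * a := by
  obtain ⟨j, -, hj⟩ := Finset.exists_max_image Finset.univ w Finset.univ_nonempty
  refine ⟨w j, hw j, fun n x => ?_⟩
  simpa using Finset.sum_le_card_nsmul (Finset.range n) (fun k => w (x k)) (w j)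
    fun k _ => hj _ (Finset.mem_univ _)

theorem tendsto_exp_nat_mul {a : ℝ} (ha : a < 0) :
    Tendsto (fun n : ℕ => Real.exp (n * a)) atTop (𝓝 0) :=
  Real.tendsto_exp_atBot.comp (tendsto_natCast_atTop_atTop.atTop_mul_const_of_neg ha)

variable [NeZero d] {π : ShiftSpace d → ℝ} {w : Fin d → ℝ}

/-- Cover by the images of the `n`-cylinders: their diameters tend to zero uniformly, and the sum of
their `s`-th powers is at most `C ^ s` because the weights `exp (s * w i)` sum to one. -/
theorem dimH_range_le_of_isMetricPotential (hπ : IsMetricPotential π (fun x => w (x 0)))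
    (hw : ∀ i, w i < 0) {s : ℝ} (hs : 0 < s) (hsum : ∑ i, Real.exp (s * w i) = 1) :
    dimH (range π) ≤ ENNReal.ofReal s := by
  obtain ⟨C, hC0, hC⟩ := hπ
  obtain ⟨a, ha, hwa⟩ := exists_sum_le_mul hw
  have hdiam : ∀ (n : ℕ) (ω : Fin n → Fin d), Metric.ediam (π '' cylinderSet ω) ≤
      ENNReal.ofReal (C * Real.exp (∑ k, w (ω k))) := by
    intro n ω
    refine Metric.ediam_le ?_
    rintro _ ⟨x, hx, rfl⟩ _ ⟨y, hy, rfl⟩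
    rw [edist_dist, Real.dist_eq]
    refine ENNReal.ofReal_le_ofReal ?_
    have := (hC n x y fun k hk => (hx ⟨k, hk⟩).trans (hy ⟨k, hk⟩).symm).1
    rw [birkhoffSum_comp_zero, Finset.sum_range] at this
    simpa [hx _] using this
  have hle : Measure.hausdorffMeasure s (range π) ≤ ENNReal.ofReal (C ^ s) := by
    refine (Measure.hausdorffMeasure_le_liminf_sum (l := atTop) (ι := fun n : ℕ => Fin n → Fin d)
      s (range π) (fun n : ℕ => ENNReal.ofReal (C * Real.exp (n * a))) ?_
      (fun n ω => π '' cylinderSet ω) ?_ ?_).trans ?_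
    · simpa using ENNReal.tendsto_ofReal ((tendsto_exp_nat_mul ha).const_mul C)
    · refine Eventually.of_forall fun n ω => (hdiam n ω).trans (ENNReal.ofReal_le_ofReal ?_)
      have := hwa n fun k => if h : k < n then ω ⟨k, h⟩ else 0
      rw [Finset.sum_range] at this
      simp only [Fin.is_lt, dite_true] at this
      exact mul_le_mul_of_nonneg_left (Real.exp_le_exp.2 this) hC0.le
    · refine Eventually.of_forall fun n => ?_
      rintro _ ⟨x, rfl⟩
      exact mem_iUnion.2 ⟨fun k => x k, x, fun _ => rfl, rfl⟩
    · refine (liminf_le_liminf (Eventually.of_forall fun n => ?_)).trans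
        (liminf_const (f := (atTop : Filter ℕ)) (ENNReal.ofReal (C ^ s))).le
      calc ∑ ω : Fin n → Fin d, Metric.ediam (π '' cylinderSet ω) ^ s
          ≤ ∑ ω : Fin n → Fin d,
            ENNReal.ofReal (C ^ s * ∏ k, Real.exp (s * w (ω k))) := by
            refine Finset.sum_le_sum fun ω _ => ?_
            refine (ENNReal.rpow_le_rpow (hdiam n ω) hs.le).trans ?_
            rw [ENNReal.ofReal_rpow_of_pos (by positivity),
              Real.mul_rpow hC0.le (Real.exp_pos _).le, ← Real.exp_mul, ← Real.exp_sum,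
              ← Finset.mul_sum, mul_comm s]
        _ = ENNReal.ofReal (C ^ s) := by
            rw [← ENNReal.ofReal_sum_of_nonneg fun ω _ => by positivity, ← Finset.mul_sum,
              ← Fintype.sum_pow (fun i => Real.exp (s * w i)), hsum, one_pow, mul_one]
  have : dimH (range π) ≤ (s.toNNReal : ENNReal) := by
    refine dimH_le_of_hausdorffMeasure_ne_top ?_
    rw [Real.coe_toNNReal s hs.le]
    exact (hle.trans_lt ENNReal.ofReal_lt_top).ne
  exact this

/-- This is the mass distribution principle for the image of the Bernoulli measure with weights `exp
(s * w i)`. -/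
theorem le_dimH_range_of_isMetricPotential (hπ : IsMetricPotential π (fun x => w (x 0)))
    (hcont : Continuous π) (hw : ∀ i, w i < 0) {s : ℝ} (hs : 0 < s)
    (hsum : ∑ i, Real.exp (s * w i) = 1) :
    ENNReal.ofReal s ≤ dimH (range π) := by
  obtain ⟨C, hC0, hC⟩ := hπ
  obtain ⟨a, ha, hwa⟩ := exists_sum_le_mul hw
  set μ := bernoulliMeasure (fun i => s * w i) hsum with hμ
  have hpre : ∀ S : Set ℝ, μ (π ⁻¹' S) ≤ ENNReal.ofReal (C ^ s) * Metric.ediam S ^ s := by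
    intro S
    by_cases hsub : (π ⁻¹' S).Subsingleton
    -- The Bernoulli measure has no atoms, since cylinder masses decay exponentially.
    · refine le_of_eq_of_le ?_ zero_le
      rcases hsub.eq_empty_or_singleton with h | ⟨x, h⟩
      · rw [h, measure_empty]
      · rw [h]
        refine le_antisymm (ge_of_tendsto' (x := atTop)
          (f := fun n : ℕ => ENNReal.ofReal (Real.exp (n * (s * a)))) ?_ fun n => ?_) zero_le
        · simpa using ENNReal.tendsto_ofReal
            (tendsto_exp_nat_mul (mul_neg_of_pos_of_neg hs ha))
        · calc μ {x} ≤ μ {y | ∀ k < n, y k = x k} := measure_mono (by simp)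
            _ = _ := bernoulliMeasure_cylinder _ hsum x n
            _ ≤ _ := by
              refine ENNReal.ofReal_le_ofReal (Real.exp_le_exp.2 ?_)
              rw [← Finset.mul_sum, mul_left_comm]
              exact mul_le_mul_of_nonneg_left (hwa n x) hs.le
    -- At the first position where two codes of points of `S` disagree, all these codes share one
    -- cylinder, while a pair branching there bounds the diameter of `S` from below.
    · have hex : ∃ n, ∃ x ∈ π ⁻¹' S, ∃ y ∈ π ⁻¹' S, x n ≠ y n := by
        obtain ⟨x, hx, y, hy, hxy⟩ := not_subsingleton_iff.1 hsub
        obtain ⟨n, hn⟩ := Function.ne_iff.1 hxy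
        exact ⟨n, x, hx, y, hy, hn⟩
      classical
      obtain ⟨x, hx, y, hy, hxy⟩ := Nat.find_spec hex
      have hmin : ∀ k < Nat.find hex, ∀ z ∈ π ⁻¹' S, z k = x k := fun k hk z hz => by
        by_contra hne
        exact Nat.find_min hex hk ⟨z, hz, x, hx, hne⟩
      generalize Nat.find hex = n at *
      have h1 := (hC n x y fun k hk => (hmin k hk y hy).symm).2 hxy
      rw [birkhoffSum_comp_zero] at h1
      have hed : ENNReal.ofReal |π x - π y| ≤ Metric.ediam S := by
        rw [← Real.dist_eq, ← edist_dist]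
        exact Metric.edist_le_ediam_of_mem hx hy
      calc μ (π ⁻¹' S) ≤ μ {y | ∀ k < n, y k = x k} :=
            measure_mono fun z hz k hk => hmin k hk z hz
        _ = ENNReal.ofReal (Real.exp (∑ k ∈ Finset.range n, s * w (x k))) :=
            bernoulliMeasure_cylinder _ hsum x n
        _ ≤ ENNReal.ofReal (C ^ s * |π x - π y| ^ s) := by
            refine ENNReal.ofReal_le_ofReal ?_
            rw [← Finset.mul_sum, mul_comm s, Real.exp_mul,
              ← Real.mul_rpow hC0.le (abs_nonneg _)]
            exact Real.rpow_le_rpow (Real.exp_pos _).le h1 hs.le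
        _ = ENNReal.ofReal (C ^ s) * ENNReal.ofReal |π x - π y| ^ s := by
            rw [ENNReal.ofReal_mul (by positivity),
              ENNReal.ofReal_rpow_of_nonneg (abs_nonneg _) hs.le]
        _ ≤ _ := by gcongr
  have hK0 : ENNReal.ofReal (C ^ s) ≠ 0 := by
    rw [Ne, ENNReal.ofReal_eq_zero, not_le]; positivity
  have hmeas : (ENNReal.ofReal (C ^ s))⁻¹ • μ.map π ≤ Measure.hausdorffMeasure s := by
    refine Measure.le_hausdorffMeasure s _ 1 one_pos fun S _ => ?_
    -- Passing to the closure gives a measurable set of the same diameter.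
    calc ((ENNReal.ofReal (C ^ s))⁻¹ • μ.map π) S
        ≤ (ENNReal.ofReal (C ^ s))⁻¹ * μ (π ⁻¹' closure S) := by
          rw [Measure.smul_apply, smul_eq_mul,
            ← Measure.map_apply hcont.measurable isClosed_closure.measurableSet]
          gcongr
          exact subset_closure
      _ ≤ (ENNReal.ofReal (C ^ s))⁻¹ *
          (ENNReal.ofReal (C ^ s) * Metric.ediam (closure S) ^ s) := by
          gcongr; exact hpre _
      _ = Metric.ediam S ^ s := by
          rw [← mul_assoc, ENNReal.inv_mul_cancel hK0 ENNReal.ofReal_ne_top, one_mul,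
            Metric.ediam_closure]
  have : (s.toNNReal : ENNReal) ≤ dimH (range π) := by
    refine le_dimH_of_hausdorffMeasure_ne_zero ?_
    rw [Real.coe_toNNReal s hs.le]
    have h1 := hmeas (range π)
    have h2 := Measure.le_map_apply (μ := μ) hcont.measurable.aemeasurable (range π)
    rw [preimage_range, measure_univ] at h2
    rw [Measure.smul_apply, smul_eq_mul] at h1
    refine (lt_of_lt_of_le ?_ h1).ne'
    exact ENNReal.mul_pos (ENNReal.inv_ne_zero.2 ENNReal.ofReal_ne_top)
      (one_pos.trans_le h2).ne'
  exact this

end Moran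

/-! ### Gibbs measures and equivalence of essentially affine systems -/

namespace ConformalIFS

variable {d : ℕ}

theorem delta_spec {Φ : ConformalIFS d} {w : Fin d → ℝ} (hw : ∀ i, w i < 0)
    (h : HasBoundedSumDiff Φ.potential (fun x => w (x 0))) :
    0 < Φ.delta ∧ ∑ i, Real.exp (Φ.delta * w i) = 1 := by
  have : NeZero d := ⟨by have := Φ.two_le; omega⟩
  obtain ⟨s, hs, hsum⟩ := exists_sum_exp_mul_eq_one Φ.two_le hw
  have hm := Φ.isMetricPotential_coding.congr h
  have hdim : dimH Φ.limitSet = ENNReal.ofReal s := by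
    rw [← range_coding]
    exact le_antisymm (dimH_range_le_of_isMetricPotential hm hw hs hsum)
      (le_dimH_range_of_isMetricPotential hm Φ.continuous_coding hw hs hsum)
  have : Φ.delta = s := by rw [delta, hdim, ENNReal.toReal_ofReal hs.le]
  rw [this]
  exact ⟨hs, hsum⟩

/-- Bowen's formula. -/
theorem pressure_delta_mul_potential {Φ : ConformalIFS d} {w : Fin d → ℝ} (hw : ∀ i, w i < 0)
    (h : HasBoundedSumDiff Φ.potential (fun x => w (x 0))) :
    pressure (fun x => Φ.delta * Φ.potential x) = 0 := by
  have : NeZero d := ⟨by have := Φ.two_le; omega⟩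
  rw [pressure_eq_log_sum (w := fun i => Φ.delta * w i) (h.const_mul Φ.delta),
    (delta_spec hw h).2, Real.log_one]

theorem exists_hasBoundedSumDiff_permute {Φ : ConformalIFS d} (h : Φ.IsEssentiallyAffine)
    (τ : Equiv.Perm (Fin d)) : ∃ w : Fin d → ℝ, (∀ i, w i < 0) ∧
      HasBoundedSumDiff (Φ.permute τ).potential (fun x => w (x 0)) := by
  obtain ⟨w, hw, C, hC⟩ := h.exists_hasBoundedSumDiff
  refine ⟨fun i => w (τ i), fun i => hw _, C, fun n x => ?_⟩
  have := hC n fun k => τ (x k)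
  rwa [← birkhoffSum_potential_permute, birkhoffSum_comp_zero,
    ← birkhoffSum_comp_zero (fun i => w (τ i))] at this

theorem Equivalent.delta_eq {Φ Ψ : ConformalIFS d} (h : Φ.Equivalent Ψ) : Φ.delta = Ψ.delta := by
  obtain ⟨τ, h⟩ := h
  rw [h.delta_eq, delta_permute]

theorem Equivalent.lyapunovSpectrum_eq {Φ Ψ : ConformalIFS d} (h : Φ.Equivalent Ψ) :
    Φ.lyapunovSpectrum = Ψ.lyapunovSpectrum := by
  obtain ⟨τ, h⟩ := h
  rw [h.lyapunovSpectrum_eq, lyapunovSpectrum_permute]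

/-- The Bernoulli measure obtained for `Φ` serves both systems: a deformation keeps `δ`, and bounded
sum differences keep the pressure and cost only a constant in the Gibbs inequalities. -/
theorem Equivalent.gibbsEqualUpToPerm {Φ Ψ : ConformalIFS d} (hΦ : Φ.IsEssentiallyAffine)
    (h : Φ.Equivalent Ψ) : Φ.GibbsEqualUpToPerm Ψ := by
  have : NeZero d := ⟨by have := Φ.two_le; omega⟩
  obtain ⟨τ, h⟩ := h
  obtain ⟨w, hw, hb⟩ := hΦ.exists_hasBoundedSumDiff
  obtain ⟨μ, hμ⟩ := exists_isInvariantGibbs (w := fun i => Φ.delta * w i) (hb.const_mul Φ.delta)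
  have hb' := (isDeformationOf_iff.1 h).symm.const_mul Φ.delta
  have hP : pressure (fun x => Φ.delta * (Ψ.permute τ).potential x) =
      pressure (fun x => Φ.delta * Φ.potential x) := by
    rw [pressure_eq_log_sum (w := fun i => Φ.delta * w i) (hb.const_mul Φ.delta),
      pressure_eq_log_sum (w := fun i => Φ.delta * w i) (hb'.trans (hb.const_mul Φ.delta))]
  refine ⟨τ, μ, hμ, ?_⟩
  rw [IsGibbsMeasure, ← h.delta_eq]
  refine ⟨hμ.1, hμ.2, ?_⟩
  obtain ⟨C, hC0, hC⟩ := hμ.gibbs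
  obtain ⟨B, hB⟩ := hb'
  refine ⟨C * Real.exp B, by positivity, fun n ω x hx => ?_⟩
  rw [hP]
  have h1 := hC n ω x hx
  have h2 := abs_le.1 (hB n x)
  constructor
  · refine le_trans ?_ h1.1
    rw [mul_inv, mul_assoc, ← Real.exp_neg, ← Real.exp_add]
    exact mul_le_mul_of_nonneg_left (Real.exp_le_exp.2 (by linarith)) (by positivity)
  · refine h1.2.trans ?_
    rw [mul_assoc, ← Real.exp_add]
    exact mul_le_mul_of_nonneg_left (Real.exp_le_exp.2 (by linarith)) hC0.le

theorem GibbsEqualUpToPerm.equivalent {Φ Ψ : ConformalIFS d} (hΦ : Φ.IsEssentiallyAffine)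
    (hΨ : Ψ.IsEssentiallyAffine) (h : Φ.GibbsEqualUpToPerm Ψ) (hδ : Φ.delta = Ψ.delta) :
    Φ.Equivalent Ψ := by
  obtain ⟨τ, μ, h1, h2⟩ := h
  obtain ⟨w, hw, hb⟩ := hΦ.exists_hasBoundedSumDiff
  obtain ⟨w', hw', hb'⟩ := exists_hasBoundedSumDiff_permute hΨ τ
  have h3 := IsInvariantGibbs.hasBoundedSumDiff h1 h2
    ((pressure_delta_mul_potential hw hb).trans (pressure_delta_mul_potential hw' hb').symm)
  -- Equality of dimensions puts the same positive factor in front of both potentials, so it can be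
  -- cancelled.
  rw [delta_permute, ← hδ] at h3
  exact ⟨τ, isDeformationOf_iff.2 (h3.of_const_mul (delta_spec hw hb).1.ne')⟩

end ConformalIFS

theorem mainTheorem5 {d : ℕ} (Φ Ψ : ConformalIFS d)
    (hΦ : Φ.IsEssentiallyAffine) (hΨ : Ψ.IsEssentiallyAffine) :
    ((Φ.GibbsEqualUpToPerm Ψ ∧ Φ.delta = Ψ.delta) ↔ Φ.Equivalent Ψ) ∧
    ((Φ.GibbsEqualUpToPerm Ψ ∧ Φ.delta = Ψ.delta) → Φ.lyapunovSpectrum = Ψ.lyapunovSpectrum) ∧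
    (Φ.Equivalent Ψ → Φ.lyapunovSpectrum = Ψ.lyapunovSpectrum) :=
  ⟨⟨fun h => h.1.equivalent hΦ hΨ h.2, fun h => ⟨h.gibbsEqualUpToPerm hΦ, h.delta_eq⟩⟩,
    fun h => (h.1.equivalent hΦ hΨ h.2).lyapunovSpectrum_eq, fun h => h.lyapunovSpectrum_eq⟩
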